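/- Let $n\ge 1$ and let $p_1,\dots,p_n>0$ with $\sum_i p_i=1$. On a probability space with a filtration $(\mathcal F_t)_{t\ge 0}$, let $G_t=([n],E_t)$, $t=0,1,2,\dots$, be random simple undirected graphs on $[n]=\{1,\dots,n\}$, let $U_t\in[n]$ be the agent selected at time $t$, and let $x_i(t)\in\mathbb R$ be the state of agent $i$ at time $t$. Write $N_i(t)=\{j\in[n] : j=i \text{ or } \{i,j\}\in E_t\}$ for the closed neighbourhood of $i$ in $G_t$. Assume: 1. the initial states $x_i(0)$ are $\mathcal F_0$-measurable with $\mathbb E[x_i(0)^2]<\infty$; $G_t$ is $\mathcal F_t$-measurable and $U_t$ is $\mathcal F_{t+1}$-measurable for every $t$; 2. for every $t$, $U_t$ is independent of $\mathcal F_t$ (in particular of the initial states, of $G_0,\dots,G_t$ and of $U_0,\dots,U_{t-1}$), and $\mathbb P(U_t=i)=p_i$ for all $i\in[n]$; 3. for every $t$, the selected agent $i=U_t$ updates to $$x_i(t+1)=\frac{1}{|N_i(t)|}\sum_{j\in N_i(t)}x_j(t),$$ while $x_j(t+1)=x_j(t)$ for all $j\ne U_t$; 4. for every $t$, the neighbourhood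 of the selected agent $i=U_t$ can only contract, $N_i(t+1)\subseteq N_i(t)$; the edges between non-selected agents may be added or removed arbitrarily. If, almost surely, $G_t$ is connected for infinitely many $t$, then there is a random variable $x_\infty$ such that, almost surely, $$\lim_{t\to\infty}x_i(t)=x_\infty\quad\text{for all } i\in[n].$$ -/

import Mathlib

open MeasureTheory ProbabilityTheory Filter Topology
open scoped ENNReal

open Classical in
/-- The closed neighbourhood of agent `i` in the graph `G`: `i` itself together with all agents
adjacent to it. -/
noncomputable def closedNbhd {n : ℕ} (G : SimpleGraph (Fin n)) (i : Fin n) : Finset (Fin n) :=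
  Finset.univ.filter fun j => j = i ∨ G.Adj i j

/-- Asynchronous averaging on a dynamic graph with selective neighbourhood contraction.

`U t` is the agent selected at time `t`, `G t` the network at time `t`, and `x t ω i` the state of
agent `i` at time `t`. The filtration `ℱ` is the information available: `ℱ t` contains the initial
states, the networks up to and including time `t`, and the agents selected strictly before time `t`
(it may contain more, such as extra randomness used by the agents to rewire). -/
structure IsAsyncAveraging {n : ℕ} {Ω : Type*} [mΩ : MeasurableSpace Ω] (μ : Measure Ω)
    (p : Fin n → ℝ) (ℱ : Filtration ℕ mΩ) (G : ℕ → Ω → SimpleGraph (Fin n))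
    (U : ℕ → Ω → Fin n) (x : ℕ → Ω → Fin n → ℝ) : Prop where
  /-- The initial states are random variables known at time `0`. -/
  measurable_init : ∀ i, Measurable[ℱ 0] fun ω => x 0 ω i
  /-- The initial states have finite second moment. -/
  memLp_init : ∀ i, MemLp (fun ω => x 0 ω i) 2 μ
  /-- The network at time `t` is random, and known at time `t`. -/
  measurable_graph : ∀ t i j, MeasurableSet[ℱ t] {ω | (G t ω).Adj i j}
  /-- The agent selected at time `t` is known at time `t + 1`. -/
  measurable_select : ∀ t, Measurable[ℱ (t + 1)] (U t)
  /-- The selection at time `t` is independent of the information available at time `t`. -/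
  indep_select : ∀ t, Indep (MeasurableSpace.comap (U t) ⊤) (ℱ t) μ
  /-- At each time, agent `i` is selected with probability `p i`. -/
  prob_select : ∀ t i, μ.real {ω | U t ω = i} = p i
  /-- The selection probabilities are positive. -/
  prob_pos : ∀ i, 0 < p i
  /-- The selected agent moves to the average over its closed neighbourhood. -/
  update_selected : ∀ t ω, x (t + 1) ω (U t ω) =
    (∑ j ∈ closedNbhd (G t ω) (U t ω), x t ω j) / ((closedNbhd (G t ω) (U t ω)).card : ℝ)
  /-- All other agents keep their states. -/
  update_other : ∀ t ω i, i ≠ U t ω → x (t + 1) ω i = x t ω i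
  /-- The neighbourhood of the selected agent can only shrink; the rest of the network may change
  arbitrarily. -/
  contract : ∀ t ω, closedNbhd (G (t + 1) ω) (U t ω) ⊆ closedNbhd (G t ω) (U t ω)

/-!
Let `M` be the limit of the nonincreasing maximum `max_i x_i(t)`; consensus at `M` holds unless, for
some level `r < M`, infinitely often at least one agent is at or below `r`. Suppose that infinitely
often at least `k ≥ 1` agents are. The agents below `r` stay below until an edge joins the two sides
of `r`; since eventually some agent is above `r`, connectivity produces such an edge. Hence some
agent `u` is infinitely often at the upper end of a crossing edge while `k` agents lie below. By the
conditional Borel–Cantelli lemma `u` is selected at infinitely many of these times, and each time it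
is averaged with an agent below `r`. As all states are eventually at most any `c > M`, it lands at
or below `c - (c - r) / n`, which is less than `M` for `c` close to `M`. So infinitely often `k + 1`
agents are below some level less than `M`, which is absurd once `k = n`.
-/

theorem sum_div_card_le_sub_div {ι K : Type*} [Field K] [LinearOrder K] [IsStrictOrderedRing K]
    {s : Finset ι} {f : ι → K} {c δ : K} {v : ι} (hv : v ∈ s) (hc : ∀ j ∈ s, f j ≤ c)
    (hvδ : f v ≤ c - δ) : (∑ j ∈ s, f j) / s.card ≤ c - δ / s.card := by
  have hcard : (0 : K) < s.card := Nat.cast_pos.2 (Finset.card_pos.2 ⟨v, hv⟩)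
  have hgap : δ ≤ ∑ j ∈ s, (c - f j) :=
    calc δ ≤ c - f v := le_sub_comm.1 hvδ
      _ ≤ ∑ j ∈ s, (c - f j) :=
        Finset.single_le_sum (f := fun j => c - f j) (fun j hj => sub_nonneg.2 (hc j hj)) hv
  rw [Finset.sum_sub_distrib, Finset.sum_const, nsmul_eq_mul] at hgap
  rw [div_le_iff₀ hcard, sub_mul, div_mul_cancel₀ _ hcard.ne']
  linarith

section Sublevel

variable {V : Type*}

/-- The finite set of agents whose state is at most `r`. -/
noncomputable def sublevel [Fintype V] (y : V → ℝ) (r : ℝ) : Finset V :=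
  Finset.univ.filter fun i => y i ≤ r

theorem mem_sublevel [Fintype V] {y : V → ℝ} {r : ℝ} {i : V} : i ∈ sublevel y r ↔ y i ≤ r := by
  simp [sublevel]

theorem sublevel_mono [Fintype V] (y : V → ℝ) : Monotone (sublevel y) := fun _ _ hrs _ hi =>
  mem_sublevel.2 ((mem_sublevel.1 hi).trans hrs)

/-- The agent `u` is the upper end of an edge of `G` crossing the level `r` of the states `y`:
it lies strictly above `r` and has a neighbour at or below `r`. -/
def IsUpperEnd (G : SimpleGraph V) (y : V → ℝ) (r : ℝ) (u : V) : Prop :=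
  r < y u ∧ ∃ v, y v ≤ r ∧ G.Adj u v

theorem exists_isUpperEnd {G : SimpleGraph V} (hG : G.Preconnected) {y : V → ℝ} {r : ℝ} {a b : V}
    (ha : y a ≤ r) (hb : r < y b) : ∃ u, IsUpperEnd G y r u := by
  obtain ⟨walk⟩ := hG a b
  obtain ⟨d, -, hfst, hsnd⟩ := walk.exists_boundary_dart {i | y i ≤ r} ha hb.not_ge
  exact ⟨d.snd, not_le.1 hsnd, d.fst, hfst, d.adj.symm⟩

variable {Ω : Type*} {mΩ : MeasurableSpace Ω} {y : Ω → V → ℝ}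

theorem measurable_card_sublevel [Fintype V] (hy : Measurable y) (r : ℝ) :
    Measurable fun ω => (sublevel (y ω) r).card := by
  simp only [sublevel, Finset.card_filter]
  exact Finset.measurable_sum _ fun i _ =>
    Measurable.ite (measurableSet_le (hy.eval (a := i)) measurable_const)
      measurable_const measurable_const

theorem measurableSet_isUpperEnd [Countable V] {G : Ω → SimpleGraph V} (hy : Measurable y)
    (hG : ∀ i j, MeasurableSet {ω | (G ω).Adj i j}) (r : ℝ) (u : V) :
    MeasurableSet {ω | IsUpperEnd (G ω) (y ω) r u} := by
  have hbelow : MeasurableSet {ω | ∃ v, y ω v ≤ r ∧ (G ω).Adj u v} := by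
    rw [Set.ofPred_exists]
    exact MeasurableSet.iUnion fun v =>
      (measurableSet_le hy.eval measurable_const).inter (hG u v)
  exact (measurableSet_lt measurable_const hy.eval).inter hbelow

end Sublevel

section ClosedNbhd

variable {n : ℕ} {G : SimpleGraph (Fin n)} {i j : Fin n}

theorem mem_closedNbhd : j ∈ closedNbhd G i ↔ j = i ∨ G.Adj i j := by
  simp [closedNbhd]

theorem self_mem_closedNbhd (G : SimpleGraph (Fin n)) (i : Fin n) : i ∈ closedNbhd G i :=
  mem_closedNbhd.2 (Or.inl rfl)

theorem measurable_sum_closedNbhd_div_card {Ω : Type*} {mΩ : MeasurableSpace Ω}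
    {G : Ω → SimpleGraph (Fin n)} {y : Ω → Fin n → ℝ} (hy : Measurable y)
    (hG : ∀ i j, MeasurableSet {ω | (G ω).Adj i j}) (i : Fin n) :
    Measurable fun ω => (∑ j ∈ closedNbhd (G ω) i, y ω j) / ((closedNbhd (G ω) i).card : ℝ) := by
  classical
  have hmem : ∀ j, MeasurableSet {ω | j ∈ closedNbhd (G ω) i} := fun j => by
    simp only [mem_closedNbhd, Set.ofPred_or]
    exact (MeasurableSet.const _).union (hG i j)
  have hsum : ∀ f : Ω → Fin n → ℝ, Measurable f →
      Measurable fun ω => ∑ j ∈ closedNbhd (G ω) i, f ω j := fun f hf => by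
    have hite : ∀ ω, ∑ j ∈ closedNbhd (G ω) i, f ω j =
        ∑ j, if j ∈ closedNbhd (G ω) i then f ω j else 0 := fun ω => by
      rw [Finset.sum_ite_mem, Finset.univ_inter]
    simp only [hite]
    exact Finset.measurable_sum _ fun j _ => Measurable.ite (hmem j) hf.eval measurable_const
  simp_rw [Finset.cast_card]
  exact (hsum y hy).div (hsum _ measurable_const)

end ClosedNbhd

/-- A deterministic trajectory of asynchronous averaging: at time `t` the agent `U t` moves to the
average over its closed neighbourhood in `G t`, and the other agents keep their states. -/
structure IsAveragingPath {n : ℕ} (G : ℕ → SimpleGraph (Fin n)) (U : ℕ → Fin n)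
    (y : ℕ → Fin n → ℝ) : Prop where
  update_selected : ∀ t, y (t + 1) (U t) =
    (∑ j ∈ closedNbhd (G t) (U t), y t j) / ((closedNbhd (G t) (U t)).card : ℝ)
  update_other : ∀ t i, i ≠ U t → y (t + 1) i = y t i

/-- Fairness of the selection along a trajectory: an agent that is infinitely often the upper end of
an edge crossing the level `r`, while at least `k` agents are at or below `r`, is selected at
infinitely many of these times. Only rational levels are considered, so that almost sure fairness
is a countable conjunction of almost sure statements. -/
def IsFairSelection {n : ℕ} (G : ℕ → SimpleGraph (Fin n)) (U : ℕ → Fin n)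
    (y : ℕ → Fin n → ℝ) : Prop :=
  ∀ (r : ℚ) (k : ℕ) (u : Fin n),
    (∃ᶠ t in atTop, k ≤ (sublevel (y t) r).card ∧ IsUpperEnd (G t) (y t) r u) →
      ∃ᶠ t in atTop, (k ≤ (sublevel (y t) r).card ∧ IsUpperEnd (G t) (y t) r u) ∧ U t = u

namespace IsAveragingPath

variable {n : ℕ} {G : ℕ → SimpleGraph (Fin n)} {U : ℕ → Fin n} {y : ℕ → Fin n → ℝ} {t : ℕ}

theorem neg (h : IsAveragingPath G U y) : IsAveragingPath G U (-y) where
  update_selected t := by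
    simp only [Pi.neg_apply, h.update_selected t, Finset.sum_neg_distrib, neg_div]
  update_other t i hi := congrArg Neg.neg (h.update_other t i hi)

theorem selected_le (h : IsAveragingPath G U y) {b : ℝ}
    (hb : ∀ j ∈ closedNbhd (G t) (U t), y t j ≤ b) : y (t + 1) (U t) ≤ b := by
  have hself := self_mem_closedNbhd (G t) (U t)
  simpa only [h.update_selected t, zero_div, sub_zero] using
    sum_div_card_le_sub_div (δ := 0) hself hb ((hb _ hself).trans (sub_zero b).ge)

theorem selected_le_sub_div (h : IsAveragingPath G U y) {c δ : ℝ} {v : Fin n} (hδ : 0 ≤ δ)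
    (hc : ∀ j, y t j ≤ c) (hv : v ∈ closedNbhd (G t) (U t)) (hvδ : y t v ≤ c - δ) :
    y (t + 1) (U t) ≤ c - δ / n := by
  have hpos : 0 < (closedNbhd (G t) (U t)).card := Finset.card_pos.2 ⟨v, hv⟩
  have hcard : (closedNbhd (G t) (U t)).card ≤ n := card_finset_fin_le _
  calc y (t + 1) (U t) ≤ c - δ / (closedNbhd (G t) (U t)).card := by
        rw [h.update_selected t]
        exact sum_div_card_le_sub_div hv (fun j _ => hc j) hvδ
    _ ≤ c - δ / n := by gcongr

theorem sublevel_subset_succ (h : IsAveragingPath G U y) {r : ℝ}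
    (hno : ∀ u, ¬ IsUpperEnd (G t) (y t) r u) : sublevel (y t) r ⊆ sublevel (y (t + 1)) r := by
  intro i hi
  rw [mem_sublevel] at hi ⊢
  by_cases hiU : i = U t
  · subst hiU
    refine h.selected_le fun j hj => ?_
    rcases mem_closedNbhd.1 hj with rfl | hadj
    · exact hi
    · exact not_lt.1 fun hrj => hno j ⟨hrj, _, hi, hadj.symm⟩
  · exact (h.update_other t i hiU).trans_le hi

theorem forall_succ_le (h : IsAveragingPath G U y) {b : ℝ} (hb : ∀ i, y t i ≤ b) (i : Fin n) :
    y (t + 1) i ≤ b :=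
  mem_sublevel.1 (h.sublevel_subset_succ (fun u hu => hu.1.not_ge (hb u)) (mem_sublevel.2 (hb i)))

theorem forall_le_of_forall_zero_le (h : IsAveragingPath G U y) {b : ℝ} (hb : ∀ i, y 0 i ≤ b)
    (t : ℕ) : ∀ i, y t i ≤ b := by
  induction t with
  | zero => exact hb
  | succ t ih => exact h.forall_succ_le ih

theorem card_sublevel_add_one_le (h : IsAveragingPath G U y) {c r : ℝ} (hc : ∀ j, y t j ≤ c)
    (hU : IsUpperEnd (G t) (y t) r (U t)) :
    (sublevel (y t) r).card + 1 ≤ (sublevel (y (t + 1)) (c - (c - r) / n)).card := by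
  obtain ⟨hrU, v, hvr, hadj⟩ := hU
  have hδ : 0 ≤ c - r := sub_nonneg.2 (hrU.le.trans (hc _))
  have hnotMem : U t ∉ sublevel (y t) r := fun hmem => hrU.not_ge (mem_sublevel.1 hmem)
  rw [← Finset.card_cons hnotMem]
  refine Finset.card_le_card fun i hi => mem_sublevel.2 ?_
  rcases Finset.mem_cons.1 hi with rfl | hi
  · exact h.selected_le_sub_div hδ hc (mem_closedNbhd.2 (Or.inr hadj)) (by linarith)
  · have hstep : (c - r) / n ≤ c - r := div_le_self hδ (mod_cast (U t).pos)
    calc y (t + 1) i = y t i := h.update_other t i (ne_of_mem_of_not_mem hi hnotMem)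
      _ ≤ r := mem_sublevel.1 hi
      _ ≤ c - (c - r) / n := by linarith

theorem frequently_exists_isUpperEnd (h : IsAveragingPath G U y) {r : ℝ} {k : ℕ} (hk : 0 < k)
    (hconn : ∃ᶠ t in atTop, (G t).Connected) (habove : ∀ᶠ t in atTop, ∃ i, r < y t i)
    (hfreq : ∃ᶠ t in atTop, k ≤ (sublevel (y t) r).card) :
    ∃ᶠ t in atTop, ∃ u, k ≤ (sublevel (y t) r).card ∧ IsUpperEnd (G t) (y t) r u := by
  intro hno
  obtain ⟨a, ha⟩ := eventually_atTop.1 hno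
  obtain ⟨s, has, hs⟩ := frequently_atTop.1 hfreq a
  have hpersist : ∀ t ≥ s, k ≤ (sublevel (y t) r).card := by
    intro t hst
    induction t, hst using Nat.le_induction with
    | base => exact hs
    | succ t hst ih =>
      exact ih.trans (Finset.card_le_card
        (h.sublevel_subset_succ fun u hu => ha t (has.trans hst) ⟨u, ih, hu⟩))
  obtain ⟨t, ⟨hGt, b, hb⟩, hat, hst⟩ := ((hconn.and_eventually habove).and_eventually
    ((eventually_ge_atTop a).and (eventually_ge_atTop s))).exists
  obtain ⟨i, hi⟩ := Finset.card_pos.1 (hk.trans_le (hpersist t hst))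
  obtain ⟨u, hu⟩ := exists_isUpperEnd hGt.preconnected (mem_sublevel.1 hi) hb
  exact ha t hat ⟨u, hpersist t hst, hu⟩

section Limit

variable [NeZero n] {M : ℝ}

theorem exists_tendsto_iSup (h : IsAveragingPath G U y) :
    ∃ M, Tendsto (fun t => ⨆ i, y t i) atTop (𝓝 M) := by
  have hanti : Antitone fun t => ⨆ i, y t i := antitone_nat_of_succ_le fun t =>
    ciSup_le (h.forall_succ_le (le_ciSup (Finite.bddAbove_range (y t))))
  obtain ⟨b, hb⟩ := Finite.bddBelow_range (y 0)
  have hlower : ∀ t i, b ≤ y t i := fun t i => neg_le_neg_iff.1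
    (h.neg.forall_le_of_forall_zero_le (fun j => neg_le_neg (hb (Set.mem_range_self j))) t i)
  refine ⟨_, tendsto_atTop_ciInf hanti ⟨b, ?_⟩⟩
  rintro _ ⟨t, rfl⟩
  exact (hlower t 0).trans (le_ciSup (Finite.bddAbove_range (y t)) 0)

theorem exists_lt_frequently_card_sublevel_succ (h : IsAveragingPath G U y)
    (hfair : IsFairSelection G U y) (hconn : ∃ᶠ t in atTop, (G t).Connected)
    (hM : Tendsto (fun t => ⨆ i, y t i) atTop (𝓝 M)) {r : ℚ} (hr : r < M) {k : ℕ} (hk : 0 < k)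
    (hfreq : ∃ᶠ t in atTop, k ≤ (sublevel (y t) r).card) :
    ∃ q : ℚ, q < M ∧ ∃ᶠ t in atTop, k + 1 ≤ (sublevel (y t) q).card := by
  have hn : (0 : ℝ) < n := Nat.cast_pos.2 (Nat.pos_of_neZero n)
  obtain ⟨c, hMc, hcM⟩ := exists_between (lt_add_of_pos_right M (div_pos (sub_pos.2 hr) hn))
  have hlevel : c - (c - r) / n < M := by
    have : (M - r) / n ≤ (c - r) / n := by gcongr
    linarith
  obtain ⟨q, hcq, hqM⟩ := exists_rat_btwn hlevel
  refine ⟨q, hqM, ?_⟩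
  have habove : ∀ᶠ t in atTop, ∃ i, (r : ℝ) < y t i :=
    (hM.eventually_const_lt hr).mono fun t => exists_lt_of_lt_ciSup
  have hbelow : ∀ᶠ t in atTop, ∀ i, y t i ≤ c :=
    (hM.eventually_lt_const hMc).mono fun t ht i =>
      (le_ciSup (Finite.bddAbove_range (y t)) i).trans ht.le
  obtain ⟨u, hu⟩ :=
    frequently_exists.1 (h.frequently_exists_isUpperEnd hk hconn habove hfreq)
  refine (tendsto_add_atTop_nat 1).frequently
    (((hfair r k u hu).and_eventually hbelow).mono ?_)
  rintro t ⟨⟨⟨hkt, hut⟩, rfl⟩, hct⟩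
  calc k + 1 ≤ (sublevel (y t) r).card + 1 := by gcongr
    _ ≤ (sublevel (y (t + 1)) (c - (c - r) / n)).card := h.card_sublevel_add_one_le hct hut
    _ ≤ (sublevel (y (t + 1)) q).card := Finset.card_le_card (sublevel_mono _ hcq.le)

theorem eventually_forall_lt (h : IsAveragingPath G U y) (hfair : IsFairSelection G U y)
    (hconn : ∃ᶠ t in atTop, (G t).Connected) (hM : Tendsto (fun t => ⨆ i, y t i) atTop (𝓝 M))
    {r : ℝ} (hr : r < M) : ∀ᶠ t in atTop, ∀ i, r < y t i := by
  by_contra hnot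
  obtain ⟨q₀, hrq₀, hq₀M⟩ := exists_rat_btwn hr
  have hmany : ∀ k : ℕ, ∃ q : ℚ, q < M ∧ ∃ᶠ t in atTop, k + 1 ≤ (sublevel (y t) q).card := by
    intro k
    induction k with
    | zero =>
      refine ⟨q₀, hq₀M, (not_eventually.1 hnot).mono fun t ht => ?_⟩
      obtain ⟨i, hi⟩ := not_forall.1 ht
      exact Finset.card_pos.2 ⟨i, mem_sublevel.2 ((not_lt.1 hi).trans hrq₀.le)⟩
    | succ k ih =>
      obtain ⟨q, hqM, hq⟩ := ih
      exact h.exists_lt_frequently_card_sublevel_succ hfair hconn hM hqM k.succ_pos hq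
  obtain ⟨q, -, hq⟩ := hmany n
  obtain ⟨t, ht⟩ := hq.exists
  exact (card_finset_fin_le _).not_gt ht

theorem exists_tendsto (h : IsAveragingPath G U y) (hfair : IsFairSelection G U y)
    (hconn : ∃ᶠ t in atTop, (G t).Connected) :
    ∃ l, ∀ i, Tendsto (fun t => y t i) atTop (𝓝 l) := by
  obtain ⟨M, hM⟩ := h.exists_tendsto_iSup
  refine ⟨M, fun i => tendsto_order.2 ⟨fun r hr => ?_, fun c hc => ?_⟩⟩
  · exact (h.eventually_forall_lt hfair hconn hM hr).mono fun t ht => ht i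
  · exact (hM.eventually_lt_const hc).mono fun t ht =>
      (le_ciSup (Finite.bddAbove_range (y t)) i).trans_lt ht

end Limit

end IsAveragingPath

section BorelCantelli

variable {Ω : Type*} [mΩ : MeasurableSpace Ω] {μ : Measure Ω} [IsFiniteMeasure μ]
  {ℱ : Filtration ℕ mΩ} {A B : ℕ → Set Ω}

theorem ae_frequently_mem_iff_tendsto_sum_condExp (hB : ∀ t, MeasurableSet[ℱ (t + 1)] (B t)) :
    ∀ᵐ ω ∂μ, (∃ᶠ t in atTop, ω ∈ B t) ↔
      Tendsto (fun n => ∑ t ∈ Finset.range n, (μ[(B t).indicator (1 : Ω → ℝ) | ℱ t]) ω)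
        atTop atTop := by
  let s : ℕ → Set Ω := fun t => Nat.casesOn t ∅ B
  have hs : ∀ t, MeasurableSet[ℱ t] (s t) := by
    rintro (_ | t)
    · exact MeasurableSpace.measurableSet_empty _
    · exact hB t
  filter_upwards [ae_mem_limsup_atTop_iff μ hs] with ω hω
  rwa [← limsup_nat_add s 1, mem_limsup_iff_frequently_mem] at hω

theorem ae_frequently_mem_inter_of_frequently_mem (hA : ∀ t, MeasurableSet[ℱ t] (A t))
    (hB : ∀ t, MeasurableSet[ℱ (t + 1)] (B t)) {q : ℝ} (hq : 0 < q)
    (hqB : ∀ t, ∀ᵐ ω ∂μ, q ≤ (μ[(B t).indicator (1 : Ω → ℝ) | ℱ t]) ω) :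
    ∀ᵐ ω ∂μ, (∃ᶠ t in atTop, ω ∈ A t) → ∃ᶠ t in atTop, ω ∈ A t ∩ B t := by
  have hAB : ∀ t, MeasurableSet[ℱ (t + 1)] (A t ∩ B t) := fun t =>
    MeasurableSet.inter (ℱ.mono t.le_succ _ (hA t)) (hB t)
  have hcond : ∀ t, ∀ᵐ ω ∂μ, (A t).indicator (fun _ => q) ω ≤
      (μ[(A t ∩ B t).indicator (1 : Ω → ℝ) | ℱ t]) ω := by
    intro t
    have hint : Integrable ((B t).indicator (1 : Ω → ℝ)) μ :=
      (integrable_const (1 : ℝ)).indicator (ℱ.le _ _ (hB t))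
    rw [← Set.indicator_indicator]
    filter_upwards [condExp_indicator hint (hA t), hqB t] with ω hω hqω
    rw [hω]
    exact Set.indicator_le_indicator hqω
  filter_upwards [ae_frequently_mem_iff_tendsto_sum_condExp hAB, ae_all_iff.2 hcond]
    with ω hiff hle hfreq
  have hdiv : Tendsto (fun n => ∑ t ∈ Finset.range n, (A t).indicator (fun _ => q) ω)
      atTop atTop := by
    rw [← mem_limsup_iff_frequently_mem, Set.limsup_eq_tendsto_sum_indicator_atTop hq A] at hfreq
    exact hfreq
  exact hiff.2 (tendsto_atTop_mono (fun n => Finset.sum_le_sum fun t _ => hle t) hdiv)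

end BorelCantelli

theorem condExp_indicator_one_of_indep {Ω : Type*} {m₁ m₂ m : MeasurableSpace Ω} {μ : Measure Ω}
    (hm₁ : m₁ ≤ m) (hm₂ : m₂ ≤ m) [SigmaFinite (μ.trim hm₂)] (hindep : Indep m₁ m₂ μ) {B : Set Ω}
    (hB : MeasurableSet[m₁] B) : μ[B.indicator (1 : Ω → ℝ) | m₂] =ᵐ[μ] fun _ => μ.real B := by
  rw [← integral_indicator_one (hm₁ _ hB)]
  exact condExp_indep_eq hm₁ hm₂ (stronglyMeasurable_one.indicator hB) hindep

theorem ae_isFairSelection {n : ℕ} {Ω : Type*} [mΩ : MeasurableSpace Ω] {μ : Measure Ω}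
    [IsFiniteMeasure μ] {p : Fin n → ℝ} {ℱ : Filtration ℕ mΩ}
    {G : ℕ → Ω → SimpleGraph (Fin n)} {U : ℕ → Ω → Fin n} {x : ℕ → Ω → Fin n → ℝ}
    (hx : Adapted ℱ x) (hG : ∀ t i j, MeasurableSet[ℱ t] {ω | (G t ω).Adj i j})
    (hU : ∀ t, Measurable[ℱ (t + 1)] (U t)) (hp : ∀ i, 0 < p i)
    (hsel : ∀ t i, ∀ᵐ ω ∂μ, p i ≤ (μ[{ω | U t ω = i}.indicator (1 : Ω → ℝ) | ℱ t]) ω) :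
    ∀ᵐ ω ∂μ, IsFairSelection (fun t => G t ω) (fun t => U t ω) (fun t => x t ω) := by
  simp only [IsFairSelection, ae_all_iff]
  intro r k u
  refine ae_frequently_mem_inter_of_frequently_mem
    (A := fun t => {ω | k ≤ (sublevel (x t ω) r).card ∧ IsUpperEnd (G t ω) (x t ω) r u})
    (fun t => ?_) (fun t => hU t (measurableSet_singleton u)) (hp u) (fun t => hsel t u)
  exact MeasurableSet.inter (measurable_card_sublevel (hx t) r measurableSet_Ici)
    (measurableSet_isUpperEnd (hx t) (hG t) r u)

theorem theorem1_general {n : ℕ} {Ω : Type*} [mΩ : MeasurableSpace Ω] (μ : Measure Ω)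
    [IsProbabilityMeasure μ] (p : Fin n → ℝ) (ℱ : Filtration ℕ mΩ)
    (G : ℕ → Ω → SimpleGraph (Fin n)) (U : ℕ → Ω → Fin n) (x : ℕ → Ω → Fin n → ℝ)
    (hx : Adapted ℱ x) (hG : ∀ t i j, MeasurableSet[ℱ t] {ω | (G t ω).Adj i j})
    (hU : ∀ t, Measurable[ℱ (t + 1)] (U t)) (hp : ∀ i, 0 < p i)
    (hsel : ∀ t i, ∀ᵐ ω ∂μ, p i ≤ (μ[{ω | U t ω = i}.indicator (1 : Ω → ℝ) | ℱ t]) ω)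
    (hpath : ∀ᵐ ω ∂μ, IsAveragingPath (fun t => G t ω) (fun t => U t ω) (fun t => x t ω))
    (hconn : ∀ᵐ ω ∂μ, ∃ᶠ t in atTop, (G t ω).Connected) :
    ∃ xlim : Ω → ℝ, Measurable xlim ∧
      ∀ᵐ ω ∂μ, ∀ i, Tendsto (fun t => x t ω i) atTop (𝓝 (xlim ω)) := by
  obtain ⟨ω₀⟩ := nonempty_of_isProbabilityMeasure μ
  have : NeZero n := ⟨(U 0 ω₀).pos.ne'⟩
  have hlim : ∀ᵐ ω ∂μ, ∃ l, ∀ i, Tendsto (fun t => x t ω i) atTop (𝓝 l) := by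
    filter_upwards [hpath, ae_isFairSelection hx hG hU hp hsel, hconn] with ω hω hfair hconnω
    exact hω.exists_tendsto hfair hconnω
  obtain ⟨xlim, hmeas, hxlim⟩ := measurable_limit_of_tendsto_metrizable_ae
    (fun t => hx.measurable.eval.aemeasurable) (hlim.mono fun ω ⟨l, hl⟩ => ⟨l, hl 0⟩)
  refine ⟨xlim, hmeas, ?_⟩
  filter_upwards [hlim, hxlim] with ω ⟨l, hl⟩ hω
  rwa [tendsto_nhds_unique hω (hl 0)]

namespace IsAsyncAveraging

variable {n : ℕ} {Ω : Type*} [mΩ : MeasurableSpace Ω] {μ : Measure Ω} {p : Fin n → ℝ}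
  {ℱ : Filtration ℕ mΩ} {G : ℕ → Ω → SimpleGraph (Fin n)} {U : ℕ → Ω → Fin n}
  {x : ℕ → Ω → Fin n → ℝ}

theorem isAveragingPath (h : IsAsyncAveraging μ p ℱ G U x) (ω : Ω) :
    IsAveragingPath (fun t => G t ω) (fun t => U t ω) (fun t => x t ω) where
  update_selected t := h.update_selected t ω
  update_other t := h.update_other t ω

theorem adapted (h : IsAsyncAveraging μ p ℱ G U x) : Adapted ℱ x := by
  intro t
  induction t with
  | zero => exact @measurable_pi_lambda _ _ _ (ℱ 0) _ _ h.measurable_init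
  | succ t ih =>
    refine @measurable_pi_lambda _ _ _ (ℱ (t + 1)) _ _ fun i => ?_
    have hle : ℱ t ≤ ℱ (t + 1) := ℱ.mono t.le_succ
    have hupdate : (fun ω => x (t + 1) ω i) = fun ω => if U t ω = i then
        (∑ j ∈ closedNbhd (G t ω) i, x t ω j) / ((closedNbhd (G t ω) i).card : ℝ)
          else x t ω i := by
      funext ω
      split_ifs with hi
      · exact hi ▸ h.update_selected t ω
      · exact h.update_other t ω i (Ne.symm hi)
    rw [hupdate]
    exact Measurable.ite (h.measurable_select t (measurableSet_singleton i))
      ((measurable_sum_closedNbhd_div_card ih (h.measurable_graph t) i).mono hle le_rfl)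
      (((measurable_pi_apply i).comp ih).mono hle le_rfl)

theorem le_condExp_select [IsFiniteMeasure μ] (h : IsAsyncAveraging μ p ℱ G U x) (t : ℕ)
    (i : Fin n) : ∀ᵐ ω ∂μ, p i ≤ (μ[{ω | U t ω = i}.indicator (1 : Ω → ℝ) | ℱ t]) ω := by
  have hU : MeasurableSpace.comap (U t) ⊤ ≤ mΩ :=
    ((h.measurable_select t).mono (ℱ.le _) le_rfl).comap_le
  filter_upwards [condExp_indicator_one_of_indep hU (ℱ.le t) (h.indep_select t)
    ⟨{i}, trivial, rfl⟩] with ω hω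
  exact ((h.prob_select t i).symm.trans hω.symm).le

end IsAsyncAveraging

theorem theorem1 {n : ℕ} {Ω : Type*} [mΩ : MeasurableSpace Ω] (μ : Measure Ω)
    [IsProbabilityMeasure μ] (p : Fin n → ℝ) (ℱ : Filtration ℕ mΩ)
    (G : ℕ → Ω → SimpleGraph (Fin n)) (U : ℕ → Ω → Fin n) (x : ℕ → Ω → Fin n → ℝ)
    (hmodel : IsAsyncAveraging μ p ℱ G U x)
    (hconn : ∀ᵐ ω ∂μ, ∃ᶠ t in atTop, (G t ω).Connected) :
    ∃ xlim : Ω → ℝ, Measurable xlim ∧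
      ∀ᵐ ω ∂μ, ∀ i, Tendsto (fun t => x t ω i) atTop (𝓝 (xlim ω)) :=
  theorem1_general μ p ℱ G U x hmodel.adapted hmodel.measurable_graph hmodel.measurable_select
    hmodel.prob_pos hmodel.le_condExp_select (ae_of_all μ hmodel.isAveragingPath) hconn
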